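/- Let $p$ be a prime and let $G$ be a $p$-adic analytic group, that is, a group which is also a finite-dimensional analytic manifold over $\mathbb{Q}_p$ such that multiplication and inversion are analytic maps. Let $k$ be a field of positive characteristic (not necessarily equal to $p$), and let $\mathrm{Rep}_k(G)$ be the category of all representations of the abstract group $G$ on $k$-vector spaces. Call $V \in \mathrm{Rep}_k(G)$ smooth if the action map $G \times V \to V$ is continuous when $V$ carries the discrete topology. Let $$0 \to V_1 \to V_2 \to V_3 \to 0$$ be a short exact sequence in $\mathrm{Rep}_k(G)$. If $V_1$ and $V_3$ are smooth, then $V_2$ is smooth. -/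

import Mathlib

open scoped Manifold ContDiff

universe u v w

/-- A representation `ρ` of a topological group `G` on a `k`-module `V` is *smooth* if the action
map `G × V → V`, `(g, v) ↦ ρ g v`, is continuous when `V` carries the discrete topology (and
`G × V` the product topology). -/
def Representation.IsSmooth {k G V : Type*} [CommSemiring k] [Group G] [TopologicalSpace G]
    [AddCommMonoid V] [Module k V] (ρ : Representation k G V) : Prop :=
  letI : TopologicalSpace V := ⊥
  Continuous fun x : G × V => ρ x.1 x.2

open Topology Set

/-! Fix `v` in `V₂` and put c(y) = y v - v. On the open stabilizer `K` of the image of `v` in `V₃`,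
exactness puts c(y) in the image of `V₁`, so every c(y) is a smooth vector. The difficulty is that c
is not known to be continuous: fixing `v` on a dense subset of a neighbourhood of 1 is not enough.

Take q = p · char k, so that q kills `k` while iterated q-th powers in the coordinate subgroup tend
to 1. For a in `K` and in that subgroup, some h = a^(q^m) fixes c(a), hence also c(h). On the
compact closure B of the powers of h, commutativity and closedness of open stabilizers show that B
fixes c(y) for all y in B. Thus c is additive on powers of y and c(y^q) = q c(y) = 0. By compactness
these q-th powers contain the whole closed subgroup generated by h^q, which therefore fixes `v`
(`topologicalClosure_zpowers_pow_le_vectorStabilizer`).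

Do this for one a in each coordinate direction. Ordered products of the resulting closed subgroups
fill a neighbourhood of 1 (`mem_of_topologicalClosure_zpowers_le`). Analyticity enters only through
strict differentiability of multiplication at the identity. -/

/-- Coordinates on a compact open subgroup of a `p`-adic analytic group, in which
translations are isometries up to an error of relative size `‖q‖ ^ 2`. -/
structure StandardCoordinates (p q d : ℕ) [Fact p.Prime] (G : Type*) [Group G]
    [TopologicalSpace G] where
  /-- The domain of the coordinates. -/
  carrier : Subgroup G
  isOpen : IsOpen (carrier : Set G)
  isCompact : IsCompact (carrier : Set G)
  /-- The coordinate function, with junk values outside of `carrier`. -/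
  coord : G → Fin d → ℚ_[p]
  continuousOn : ContinuousOn coord carrier
  injOn : InjOn coord carrier
  coord_one : coord 1 = 0
  /-- The image of the coordinates contains the ball of radius `‖q‖ ^ radius`. -/
  radius : ℕ
  exists_coord_eq : ∀ x, ‖x‖ ≤ ‖(q : ℚ_[p])‖ ^ radius → ∃ g ∈ carrier, coord g = x
  mem_of_small : ∀ W ∈ 𝓝 (1 : G), ∃ n : ℕ, ∀ g ∈ carrier, ‖coord g‖ ≤ ‖(q : ℚ_[p])‖ ^ n → g ∈ W
  norm_mul_left_sub : ∀ g ∈ carrier, ∀ h ∈ carrier, ∀ h' ∈ carrier,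
    ‖coord (g * h) - coord (g * h') - (coord h - coord h')‖ ≤
      ‖(q : ℚ_[p])‖ ^ 2 * ‖coord h - coord h'‖
  norm_mul_right_sub : ∀ g ∈ carrier, ∀ h ∈ carrier, ∀ h' ∈ carrier,
    ‖coord (h * g) - coord (h' * g) - (coord h - coord h')‖ ≤
      ‖(q : ℚ_[p])‖ ^ 2 * ‖coord h - coord h'‖

/-! ### Ultrametric bounds and p-adic digits. -/

namespace IsUltrametricDist

variable {F : Type*} [SeminormedAddCommGroup F] [IsUltrametricDist F]

theorem norm_add_le_of_norm_le {x y : F} {c : ℝ} (hx : ‖x‖ ≤ c) (hy : ‖y‖ ≤ c) : ‖x + y‖ ≤ c :=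
  (norm_add_le_max x y).trans (max_le hx hy)

end IsUltrametricDist

open IsUltrametricDist (norm_add_le_of_norm_le)

theorem Padic.norm_natCast_le_one {p : ℕ} [Fact p.Prime] (a : ℕ) : ‖(a : ℚ_[p])‖ ≤ 1 := by
  simpa using Padic.norm_int_le_one (p := p) (a : ℤ)

/-- A point of a polydisc can be approximated by natural multiples of its radius. -/
theorem Padic.exists_nat_smul_approx {p q d : ℕ} [Fact p.Prime] (hq : q ≠ 0) (n : ℕ)
    (x : Fin d → ℚ_[p]) (hx : ‖x‖ ≤ ‖(q : ℚ_[p])‖ ^ n) :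
    ∃ a : Fin d → ℕ, ∀ i, ‖x i - a i * (q : ℚ_[p]) ^ n‖ ≤ ‖(q : ℚ_[p])‖ ^ (n + 1) := by
  have hq' : (q : ℚ_[p]) ≠ 0 := by exact_mod_cast hq
  have hr : 0 < ‖(q : ℚ_[p])‖ := norm_pos_iff.2 hq'
  have : ∀ i, ∃ a : ℕ, ‖x i - a * (q : ℚ_[p]) ^ n‖ ≤ ‖(q : ℚ_[p])‖ ^ (n + 1) := fun i => by
    have hy : ‖x i / (q : ℚ_[p]) ^ n‖ ≤ 1 := by
      rw [norm_div, norm_pow, div_le_one (by positivity)]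
      exact (norm_le_pi_norm x i).trans hx
    obtain ⟨y, hyx⟩ : ∃ y : ℤ_[p], (y : ℚ_[p]) = x i / (q : ℚ_[p]) ^ n := ⟨⟨_, hy⟩, rfl⟩
    obtain ⟨a, ha⟩ := PadicInt.denseRange_natCast.exists_dist_lt y hr
    refine ⟨a, ?_⟩
    replace ha : ‖x i / (q : ℚ_[p]) ^ n - a‖ < ‖(q : ℚ_[p])‖ := by
      rwa [dist_eq_norm, PadicInt.norm_def, PadicInt.coe_sub, PadicInt.coe_natCast, hyx] at ha
    have e : x i - a * (q : ℚ_[p]) ^ n = (x i / (q : ℚ_[p]) ^ n - a) * (q : ℚ_[p]) ^ n := by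
      field_simp
    rw [e, norm_mul, norm_pow, pow_succ, mul_comm]
    gcongr
  choose a ha using this
  exact ⟨a, ha⟩

/-! ### Powers and ordered products in standard coordinates. -/

namespace StandardCoordinates

variable {p q d : ℕ} [Fact p.Prime] {G : Type*} [Group G] [TopologicalSpace G]
  (κ : StandardCoordinates p q d G)

theorem setOf_norm_coord_le_mem_nhds (hq : q ≠ 0) (n : ℕ) :
    {g | g ∈ κ.carrier ∧ ‖κ.coord g‖ ≤ ‖(q : ℚ_[p])‖ ^ n} ∈ 𝓝 (1 : G) := by
  have hr : 0 < ‖(q : ℚ_[p])‖ := norm_pos_iff.2 (by exact_mod_cast hq)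
  have hU : (κ.carrier : Set G) ∈ 𝓝 (1 : G) := κ.isOpen.mem_nhds κ.carrier.one_mem
  have hc : ContinuousAt κ.coord 1 := κ.continuousOn.continuousAt hU
  have := hc.norm.eventually_lt (continuousAt_const (y := ‖(q : ℚ_[p])‖ ^ n))
    (by simp [κ.coord_one, hr])
  filter_upwards [hU, this] with g h₁ h₂ using ⟨h₁, h₂.le⟩

/-- Each further factor `g` costs an error of the same size, and ultrametricity keeps these errors
from accumulating, so the bound does not depend on `a`. -/
theorem norm_coord_pow_sub {g : G} (hg : g ∈ κ.carrier) (a : ℕ) :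
    ‖κ.coord (g ^ a) - (a : ℚ_[p]) • κ.coord g‖ ≤ ‖(q : ℚ_[p])‖ ^ 2 * ‖κ.coord g‖ := by
  induction a with
  | zero => simp only [pow_zero, κ.coord_one, Nat.cast_zero, zero_smul, sub_zero, norm_zero]
            positivity
  | succ a ih =>
    have h := κ.norm_mul_left_sub _ (κ.carrier.pow_mem hg a) g hg 1 κ.carrier.one_mem
    rw [mul_one, κ.coord_one, sub_zero, ← pow_succ] at h
    have e : κ.coord (g ^ (a + 1)) - ((a + 1 : ℕ) : ℚ_[p]) • κ.coord g =
      (κ.coord (g ^ (a + 1)) - κ.coord (g ^ a) - κ.coord g) +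
        (κ.coord (g ^ a) - (a : ℚ_[p]) • κ.coord g) := by
      push_cast
      rw [add_smul, one_smul]
      abel
    rw [e]
    exact norm_add_le_of_norm_le h ih

theorem norm_coord_pow_sub_smul {g : G} (hg : g ∈ κ.carrier) {n : ℕ} {x : Fin d → ℚ_[p]}
    (hx : ‖x‖ ≤ ‖(q : ℚ_[p])‖ ^ n) (h : ‖κ.coord g - x‖ ≤ ‖(q : ℚ_[p])‖ ^ (n + 1)) (a : ℕ) :
    ‖κ.coord (g ^ a) - (a : ℚ_[p]) • x‖ ≤
      max (‖(q : ℚ_[p])‖ ^ (n + 2)) (‖(a : ℚ_[p])‖ * ‖(q : ℚ_[p])‖ ^ (n + 1)) := by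
  have hr : ‖(q : ℚ_[p])‖ ≤ 1 := Padic.norm_natCast_le_one q
  have hκ : ‖κ.coord g‖ ≤ ‖(q : ℚ_[p])‖ ^ n := by
    have := norm_add_le_of_norm_le (h.trans (pow_le_pow_of_le_one (norm_nonneg _) hr n.le_succ)) hx
    rwa [sub_add_cancel] at this
  have e : κ.coord (g ^ a) - (a : ℚ_[p]) • x = (κ.coord (g ^ a) - (a : ℚ_[p]) • κ.coord g) +
      (a : ℚ_[p]) • (κ.coord g - x) := by
    rw [smul_sub]
    abel
  rw [e]
  refine norm_add_le_of_norm_le (le_max_of_le_left ?_) (le_max_of_le_right ?_)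
  · refine (κ.norm_coord_pow_sub hg a).trans ?_
    rw [pow_add, mul_comm]
    gcongr
  · rw [norm_smul]
    gcongr

/-- Raising to the power `q ^ m` multiplies the leading term by `q ^ m`. -/
theorem norm_coord_pow_pow_sub {g : G} (hg : g ∈ κ.carrier) {n : ℕ} {x : Fin d → ℚ_[p]}
    (hx : ‖x‖ ≤ ‖(q : ℚ_[p])‖ ^ n) (h : ‖κ.coord g - x‖ ≤ ‖(q : ℚ_[p])‖ ^ (n + 1)) (m : ℕ) :
    ‖κ.coord (g ^ q ^ m) - (q : ℚ_[p]) ^ m • x‖ ≤ ‖(q : ℚ_[p])‖ ^ (n + m + 1) := by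
  induction m with
  | zero => simpa using h
  | succ m ih =>
    have hx' : ‖(q : ℚ_[p]) ^ m • x‖ ≤ ‖(q : ℚ_[p])‖ ^ (n + m) := by
      rw [norm_smul, norm_pow, pow_add, mul_comm]
      gcongr
    have := κ.norm_coord_pow_sub_smul (κ.carrier.pow_mem hg (q ^ m)) hx' ih q
    -- For the exponent `q` both error terms equal `‖q‖ ^ (n + m + 2)`; a relative error of only
    -- `‖q‖` in the coordinates would lose one power here.
    rw [← pow_mul, ← pow_succ, smul_smul, ← pow_succ', ← pow_succ', max_self] at this
    exact this

/-- To first order, a change of a product is the sum of the changes of the factors. -/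
theorem norm_coord_list_prod_sub (hq : ‖(q : ℚ_[p])‖ ≤ 1) {n : ℕ} (m : ℕ) (f f' : Fin m → G)
    (hf : ∀ i, f i ∈ κ.carrier) (hf' : ∀ i, f' i ∈ κ.carrier)
    (h : ∀ i, ‖κ.coord (f' i) - κ.coord (f i)‖ ≤ ‖(q : ℚ_[p])‖ ^ n) :
    ‖κ.coord (List.ofFn f').prod - κ.coord (List.ofFn f).prod -
      ∑ i, (κ.coord (f' i) - κ.coord (f i))‖ ≤ ‖(q : ℚ_[p])‖ ^ (n + 1) := by
  have hle : ∀ {t : ℝ}, t ≤ ‖(q : ℚ_[p])‖ ^ n →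
      ‖(q : ℚ_[p])‖ ^ 2 * t ≤ ‖(q : ℚ_[p])‖ ^ (n + 1) := fun {t} ht =>
    calc ‖(q : ℚ_[p])‖ ^ 2 * t ≤ ‖(q : ℚ_[p])‖ ^ 2 * ‖(q : ℚ_[p])‖ ^ n := by gcongr
      _ = ‖(q : ℚ_[p])‖ ^ (n + 2) := by rw [pow_add, mul_comm]
      _ ≤ _ := pow_le_pow_of_le_one (norm_nonneg _) hq (by lia)
  induction m with
  | zero => simp only [List.ofFn_zero, sub_self, Finset.univ_eq_empty, Finset.sum_empty, norm_zero]
            positivity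
  | succ m ih =>
    have ih := ih (fun i => f (Fin.succ i)) (fun i => f' (Fin.succ i)) (fun i => hf _)
      (fun i => hf' _) (fun i => h _)
    have memT : (List.ofFn fun i => f i.succ).prod ∈ κ.carrier :=
      list_prod_mem (List.forall_mem_ofFn_iff.2 fun i => hf _)
    have memT' : (List.ofFn fun i => f' i.succ).prod ∈ κ.carrier :=
      list_prod_mem (List.forall_mem_ofFn_iff.2 fun i => hf' _)
    rw [List.ofFn_succ, List.ofFn_succ, List.prod_cons, List.prod_cons, Fin.sum_univ_succ]
    set T := (List.ofFn fun i => f i.succ).prod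
    set T' := (List.ofFn fun i => f' i.succ).prod
    have hT : ‖κ.coord T' - κ.coord T‖ ≤ ‖(q : ℚ_[p])‖ ^ n := by
      have := norm_add_le_of_norm_le (ih.trans (pow_le_pow_of_le_one (norm_nonneg _) hq n.le_succ))
        (IsUltrametricDist.norm_sum_le_of_forall_le_of_nonneg (s := Finset.univ) (by positivity)
          (fun i _ => h (Fin.succ i)))
      rwa [sub_add_cancel] at this
    -- Change the head first, with the new tail on its right, and then the tail, with the old head
    -- on its left.
    have h₁ := (κ.norm_mul_right_sub T' memT' _ (hf' 0) _ (hf 0)).trans (hle (h 0))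
    have h₂ := (κ.norm_mul_left_sub _ (hf 0) _ memT' _ memT).trans (hle hT)
    refine (congrArg norm ?_).trans_le (norm_add_le_of_norm_le (norm_add_le_of_norm_le h₁ h₂) ih)
    abel

/-- Elements whose leading terms are `q ^ M` times the standard basis vectors generate, by ordered
products of their powers, a dense subset of the ball of radius `‖q‖ ^ M`. -/
theorem exists_norm_coord_prod_sub_le (hq : q ≠ 0) {M : ℕ} {b : Fin d → G}
    (hb : ∀ i, b i ∈ κ.carrier)
    (hbM : ∀ i, ‖κ.coord (b i) - (q : ℚ_[p]) ^ M • Pi.single i 1‖ ≤ ‖(q : ℚ_[p])‖ ^ (M + 1))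
    {x : Fin d → ℚ_[p]} (hx : ‖x‖ ≤ ‖(q : ℚ_[p])‖ ^ M) (n : ℕ) :
    ∃ e : Fin d → ℕ, ‖κ.coord (List.ofFn fun i => b i ^ e i).prod - x‖ ≤
      ‖(q : ℚ_[p])‖ ^ (M + n) := by
  have hr : ‖(q : ℚ_[p])‖ ≤ 1 := Padic.norm_natCast_le_one q
  induction n with
  | zero =>
    refine ⟨0, ?_⟩
    have : (List.ofFn fun i : Fin d => b i ^ (0 : Fin d → ℕ) i).prod = 1 :=
      List.prod_eq_one (by simp)
    rw [this, κ.coord_one, zero_sub, norm_neg]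
    exact hx
  | succ n ih =>
    obtain ⟨e, he⟩ := ih
    rw [← norm_neg, neg_sub] at he
    obtain ⟨a, ha⟩ := Padic.exists_nat_smul_approx hq _ _ he
    have hsingle : ∀ (m : ℕ) (i : Fin d),
        ‖(q : ℚ_[p]) ^ m • (Pi.single i 1 : Fin d → ℚ_[p])‖ ≤ ‖(q : ℚ_[p])‖ ^ m := fun m i => by
      rw [norm_smul, norm_pow, Pi.norm_single, norm_one, mul_one]
    have hy : ∀ i, ‖κ.coord (b i ^ (a i * q ^ n)) -
        ((a i : ℚ_[p]) * (q : ℚ_[p]) ^ (M + n)) • Pi.single i 1‖ ≤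
          ‖(q : ℚ_[p])‖ ^ (M + n + 1) := fun i => by
      have h₁ := κ.norm_coord_pow_pow_sub (hb i) (hsingle M i) (hbM i) n
      rw [smul_smul, ← pow_add, add_comm n M] at h₁
      have h₂ := κ.norm_coord_pow_sub_smul (κ.carrier.pow_mem (hb i) _) (hsingle _ i) h₁ (a i)
      rw [← pow_mul, smul_smul, mul_comm (q ^ n)] at h₂
      refine h₂.trans (max_le (pow_le_pow_of_le_one (norm_nonneg _) hr (by lia)) ?_)
      exact mul_le_of_le_one_left (by positivity) (Padic.norm_natCast_le_one _)
    have hyn : ∀ i, ‖κ.coord (b i ^ (a i * q ^ n))‖ ≤ ‖(q : ℚ_[p])‖ ^ (M + n) := fun i => by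
      have := norm_add_le_of_norm_le
        ((hy i).trans (pow_le_pow_of_le_one (norm_nonneg _) hr (by lia)))
        (show ‖((a i : ℚ_[p]) * (q : ℚ_[p]) ^ (M + n)) • (Pi.single i 1 : Fin d → ℚ_[p])‖ ≤
            ‖(q : ℚ_[p])‖ ^ (M + n) by
          rw [mul_smul, norm_smul]
          exact (mul_le_of_le_one_left (norm_nonneg _) (Padic.norm_natCast_le_one _)).trans
            (hsingle _ _))
      rwa [sub_add_cancel] at this
    have hdiff : ∀ i, ‖κ.coord (b i ^ (e i + a i * q ^ n)) - κ.coord (b i ^ e i) -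
        κ.coord (b i ^ (a i * q ^ n))‖ ≤ ‖(q : ℚ_[p])‖ ^ (M + n + 1) := fun i => by
      have := κ.norm_mul_left_sub _ (κ.carrier.pow_mem (hb i) (e i)) _
        (κ.carrier.pow_mem (hb i) (a i * q ^ n)) 1 κ.carrier.one_mem
      rw [mul_one, κ.coord_one, sub_zero, ← pow_add] at this
      refine this.trans ?_
      calc _ ≤ ‖(q : ℚ_[p])‖ ^ 2 * ‖(q : ℚ_[p])‖ ^ (M + n) := by gcongr; exact hyn i
        _ = ‖(q : ℚ_[p])‖ ^ (M + n + 2) := by rw [pow_add _ (M + n), mul_comm]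
        _ ≤ _ := pow_le_pow_of_le_one (norm_nonneg _) hr (by lia)
    -- The extra factor `b i ^ (a i * q ^ n)` has leading term `a i * q ^ (M + n)` in direction `i`,
    -- the next digit of the remaining error.
    refine ⟨fun i => e i + a i * q ^ n, ?_⟩
    have hprod := κ.norm_coord_list_prod_sub hr (n := M + n) d (fun i => b i ^ e i)
      (fun i => b i ^ (e i + a i * q ^ n)) (fun i => κ.carrier.pow_mem (hb i) _)
      (fun i => κ.carrier.pow_mem (hb i) _) (fun i => by
        have := norm_add_le_of_norm_le
          ((hdiff i).trans (pow_le_pow_of_le_one (norm_nonneg _) hr (by lia))) (hyn i)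
        rwa [sub_add_cancel] at this)
    have hsum : ‖∑ i, (κ.coord (b i ^ (e i + a i * q ^ n)) - κ.coord (b i ^ e i)) -
        ∑ i, ((a i : ℚ_[p]) * (q : ℚ_[p]) ^ (M + n)) • (Pi.single i 1 : Fin d → ℚ_[p])‖ ≤
          ‖(q : ℚ_[p])‖ ^ (M + n + 1) := by
      rw [← Finset.sum_sub_distrib]
      refine IsUltrametricDist.norm_sum_le_of_forall_le_of_nonneg (by positivity) fun i _ => ?_
      have := norm_add_le_of_norm_le (hdiff i) (hy i)
      rwa [sub_add_sub_cancel] at this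
    have hlead : ‖∑ i, ((a i : ℚ_[p]) * (q : ℚ_[p]) ^ (M + n)) •
          (Pi.single i 1 : Fin d → ℚ_[p]) - (x - κ.coord (List.ofFn fun i => b i ^ e i).prod)‖ ≤
          ‖(q : ℚ_[p])‖ ^ (M + n + 1) := by
      rw [← norm_neg, neg_sub]
      refine (pi_norm_le_iff_of_nonneg (by positivity)).2 fun i => ?_
      simpa [Finset.sum_apply, Pi.single_apply] using ha i
    refine (congrArg norm ?_).trans_le
      (norm_add_le_of_norm_le (norm_add_le_of_norm_le hprod hsum) hlead)
    abel

/-- The ball of radius `‖q‖ ^ M` is contained in the ordered product of the closures of the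
procyclic subgroups generated by elements with leading terms `q ^ M` times the basis vectors. -/
theorem mem_of_topologicalClosure_zpowers_le [IsTopologicalGroup G] [T2Space G] (hq : q ≠ 0)
    (hq₁ : ‖(q : ℚ_[p])‖ < 1) {M : ℕ} {b : Fin d → G} (hb : ∀ i, b i ∈ κ.carrier)
    (hbM : ∀ i, ‖κ.coord (b i) - (q : ℚ_[p]) ^ M • Pi.single i 1‖ ≤ ‖(q : ℚ_[p])‖ ^ (M + 1))
    {S : Subgroup G} (hS : ∀ i, (Subgroup.zpowers (b i)).topologicalClosure ≤ S)
    {g : G} (hg : g ∈ κ.carrier) (hgM : ‖κ.coord g‖ ≤ ‖(q : ℚ_[p])‖ ^ M) : g ∈ S := by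
  set C : Fin d → Subgroup G := fun i => (Subgroup.zpowers (b i)).topologicalClosure
  have hU : IsClosed (κ.carrier : Set G) := κ.isCompact.isClosed
  have hCU : ∀ i, C i ≤ κ.carrier := fun i =>
    Subgroup.topologicalClosure_minimal _ (by simpa using hb i) hU
  have hC : ∀ i, IsCompact (C i : Set G) := fun i =>
    κ.isCompact.of_isClosed_subset (Subgroup.isClosed_topologicalClosure _) (hCU i)
  set P : Set G := (fun f : Fin d → G => (List.ofFn f).prod) '' univ.pi fun i => (C i : Set G)
  have hP : IsCompact P := by
    refine (isCompact_univ_pi hC).image ?_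
    simp only [List.ofFn_eq_map]
    exact continuous_list_prod _ fun i _ => continuous_apply i
  have hPU : P ⊆ κ.carrier := by
    rintro _ ⟨f, hf, rfl⟩
    refine list_prod_mem ?_
    simpa [List.forall_mem_ofFn_iff] using fun i => hCU i (hf i (mem_univ i))
  have hclosed : IsClosed (κ.coord '' P) := (hP.image_of_continuousOn
    (κ.continuousOn.mono hPU)).isClosed
  -- Approximation to every precision becomes membership because the image of the compact `P` is
  -- closed.
  have hmem : κ.coord g ∈ κ.coord '' P := by
    rw [← hclosed.closure_eq, Metric.mem_closure_iff]
    intro ε hε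
    obtain ⟨n, hn⟩ := exists_pow_lt_of_lt_one hε hq₁
    obtain ⟨e, he⟩ := κ.exists_norm_coord_prod_sub_le hq hb hbM hgM n
    refine ⟨_, ⟨_, ⟨fun i => b i ^ e i, fun i _ => ?_, rfl⟩, rfl⟩, ?_⟩
    · exact Subgroup.le_topologicalClosure _ (Subgroup.npow_mem_zpowers _ _)
    · rw [dist_comm, dist_eq_norm]
      exact (he.trans (pow_le_pow_of_le_one (norm_nonneg _) hq₁.le (by lia))).trans_lt hn
  obtain ⟨_, ⟨f, hf, rfl⟩, hfg⟩ := hmem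
  rw [← κ.injOn (hPU ⟨f, hf, rfl⟩) hg hfg]
  refine list_prod_mem ?_
  simpa [List.forall_mem_ofFn_iff] using fun i => hS i (hf i (mem_univ i))

end StandardCoordinates

/-! ### Existence of standard coordinates. -/

/-- Coordinates obtained from a chart at the identity in which the multiplication is strictly
differentiable at the origin. -/
theorem StandardCoordinates.nonempty_of_hasStrictFDerivAt {p q d : ℕ} [Fact p.Prime] {G : Type*}
    [Group G] [TopologicalSpace G] [IsTopologicalGroup G] (hq : q ≠ 0) (hq₁ : ‖(q : ℚ_[p])‖ < 1)
    (φ : OpenPartialHomeomorph G (Fin d → ℚ_[p])) (hφ : 1 ∈ φ.source) (hφ₀ : φ 1 = 0)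
    (hd : HasStrictFDerivAt (fun z : (Fin d → ℚ_[p]) × (Fin d → ℚ_[p]) =>
      φ (φ.symm z.1 * φ.symm z.2))
      (ContinuousLinearMap.fst ℚ_[p] _ _ + ContinuousLinearMap.snd ℚ_[p] _ _) 0) :
    Nonempty (StandardCoordinates p q d G) := by
  set F := Fin d → ℚ_[p]
  set r := ‖(q : ℚ_[p])‖
  have hr : 0 < r := norm_pos_iff.2 (by exact_mod_cast hq)
  have h0 : (0 : F) ∈ φ.target := hφ₀ ▸ φ.map_source hφ
  have hs0 : φ.symm 0 = 1 := by rw [← hφ₀, φ.left_inv hφ]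
  have hsc : ContinuousAt φ.symm 0 := φ.continuousAt_symm h0
  have hball : ∀ s ∈ 𝓝 (0 : F), ∃ n : ℕ, ∀ x : F, ‖x‖ ≤ r ^ n → x ∈ s := fun s hs => by
    obtain ⟨ε, hε, h⟩ := Metric.mem_nhds_iff.1 hs
    obtain ⟨n, hn⟩ := exists_pow_lt_of_lt_one hε hq₁
    exact ⟨n, fun x hx => h (mem_ball_zero_iff.2 (hx.trans_lt hn))⟩
  obtain ⟨s, hs, happ⟩ := hd.approximates_deriv_on_nhds (c := ‖(q : ℚ_[p])‖₊ ^ 2)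
    (Or.inr (pow_pos hr 2))
  have hsrc : ∀ᶠ z : F × F in 𝓝 0, φ.symm z.1 * φ.symm z.2 ∈ φ.source := by
    have hc : ContinuousAt (fun z : F × F => φ.symm z.1 * φ.symm z.2) 0 := by
      have h₁ : ContinuousAt (fun z : F × F => φ.symm z.1) 0 :=
        ContinuousAt.comp (f := Prod.fst) hsc continuousAt_fst
      have h₂ : ContinuousAt (fun z : F × F => φ.symm z.2) 0 :=
        ContinuousAt.comp (f := Prod.snd) hsc continuousAt_snd
      exact h₁.mul h₂
    refine hc.eventually_mem (φ.open_source.mem_nhds ?_)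
    simpa [hs0] using hφ
  obtain ⟨t₁, ht₁, t₂, ht₂, ht⟩ := mem_nhds_prod_iff.1 (Filter.inter_mem hs hsrc)
  obtain ⟨N₀, hN₀⟩ := hball _ (Filter.inter_mem (Filter.inter_mem ht₁ ht₂)
    (φ.open_target.mem_nhds h0))
  have htgt : ∀ x : F, ‖x‖ ≤ r ^ N₀ → x ∈ φ.target := fun x hx => (hN₀ x hx).2
  have hst : ∀ x y : F, ‖x‖ ≤ r ^ N₀ → ‖y‖ ≤ r ^ N₀ →
      (x, y) ∈ s ∧ φ.symm x * φ.symm y ∈ φ.source := fun x y hx hy =>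
    ht (mk_mem_prod (hN₀ x hx).1.1 (hN₀ y hy).1.2)
  have hL : ∀ x y y' : F, ‖x‖ ≤ r ^ N₀ → ‖y‖ ≤ r ^ N₀ → ‖y'‖ ≤ r ^ N₀ →
      ‖φ (φ.symm x * φ.symm y) - φ (φ.symm x * φ.symm y') - (y - y')‖ ≤ r ^ 2 * ‖y - y'‖ :=
    fun x y y' hx hy hy' => by
      simpa [Prod.norm_def] using happ _ (hst x y hx hy).1 _ (hst x y' hx hy').1
  have hR : ∀ x y y' : F, ‖x‖ ≤ r ^ N₀ → ‖y‖ ≤ r ^ N₀ → ‖y'‖ ≤ r ^ N₀ →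
      ‖φ (φ.symm y * φ.symm x) - φ (φ.symm y' * φ.symm x) - (y - y')‖ ≤ r ^ 2 * ‖y - y'‖ :=
    fun x y y' hx hy hy' => by
      simpa [Prod.norm_def] using happ _ (hst y x hy hx).1 _ (hst y' x hy' hx).1
  have hz : ‖(0 : F)‖ ≤ r ^ N₀ := by rw [norm_zero]; positivity
  have hr2 : r ^ 2 ≤ 1 := pow_le_one₀ hr.le hq₁.le
  -- Continuity of inversion only keeps inverses in the larger ball of radius `r ^ N₀`; the estimate
  -- `hR` then returns them to the ball of radius `r ^ N`.
  obtain ⟨N₁, hN₁⟩ := hball {x | ∃ y, ‖y‖ ≤ r ^ N₀ ∧ φ.symm y = (φ.symm x)⁻¹} (by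
    have hc : ContinuousAt (fun x => (φ.symm x)⁻¹) 0 := hsc.inv
    have h₁ : ∀ᶠ x in 𝓝 (0 : F), (φ.symm x)⁻¹ ∈ φ.source :=
      hc.eventually_mem (φ.open_source.mem_nhds (by simpa [hs0] using hφ))
    have hc' : ContinuousAt (fun x => φ (φ.symm x)⁻¹) 0 :=
      ContinuousAt.comp (g := φ) (by simpa [hs0] using φ.continuousAt hφ) hc
    have h₂ := hc'.eventually_mem (s := Metric.ball 0 (r ^ N₀))
      (Metric.isOpen_ball.mem_nhds (by simp [hs0, hφ₀, hr]))
    filter_upwards [h₁, h₂] with x hx₁ hx₂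
    exact ⟨_, (mem_ball_zero_iff.1 hx₂).le, φ.left_inv hx₁⟩)
  set N := max N₀ N₁
  have hNN₀ : ∀ x : F, ‖x‖ ≤ r ^ N → ‖x‖ ≤ r ^ N₀ := fun x hx =>
    hx.trans (pow_le_pow_of_le_one hr.le hq₁.le (le_max_left _ _))
  have hNN₁ : ∀ x : F, ‖x‖ ≤ r ^ N → ‖x‖ ≤ r ^ N₁ := fun x hx =>
    hx.trans (pow_le_pow_of_le_one hr.le hq₁.le (le_max_right _ _))
  have hφs : ∀ x : F, ‖x‖ ≤ r ^ N → φ (φ.symm x) = x := fun x hx =>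
    φ.right_inv (htgt x (hNN₀ x hx))
  let U : Subgroup G :=
    { carrier := φ.symm '' Metric.closedBall 0 (r ^ N)
      one_mem' := ⟨0, by simp [hr.le], hs0⟩
      mul_mem' := by
        rintro _ _ ⟨x, hx, rfl⟩ ⟨y, hy, rfl⟩
        rw [mem_closedBall_zero_iff] at hx hy
        refine ⟨φ (φ.symm x * φ.symm y), ?_, φ.left_inv (hst x y (hNN₀ x hx) (hNN₀ y hy)).2⟩
        rw [mem_closedBall_zero_iff]
        have h := hL x y 0 (hNN₀ x hx) (hNN₀ y hy) hz
        rw [hs0, mul_one, hφs x hx, sub_zero] at h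
        have h := norm_add_le_of_norm_le (h.trans ((mul_le_of_le_one_left (norm_nonneg _) hr2).trans
          hy)) (norm_add_le_of_norm_le hx hy)
        refine (congrArg norm ?_).trans_le h
        abel
      inv_mem' := by
        rintro _ ⟨x, hx, rfl⟩
        rw [mem_closedBall_zero_iff] at hx
        obtain ⟨y, hy, hyx⟩ := hN₁ x (hNN₁ x hx)
        refine ⟨y, ?_, hyx⟩
        rw [mem_closedBall_zero_iff]
        have h := hR y x 0 hy (hNN₀ x hx) hz
        rw [hs0, one_mul, hyx, mul_inv_cancel, hφ₀, ← hyx, φ.right_inv (htgt y hy), sub_zero] at h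
        have h := norm_add_le_of_norm_le (h.trans ((mul_le_of_le_one_left (norm_nonneg _) hr2).trans
          hx)) hx
        rw [← norm_neg]
        refine (congrArg norm ?_).trans_le h
        abel }
  have hUsub : (U : Set G) ⊆ φ.source := by
    rintro _ ⟨x, hx, rfl⟩
    exact φ.map_target (htgt x (hNN₀ x (mem_closedBall_zero_iff.1 hx)))
  have hUn : (U : Set G) ∈ 𝓝 (1 : G) := by
    have h := φ.symm.image_mem_nhds (x := 0) h0
      (Metric.closedBall_mem_nhds (0 : F) (pow_pos hr N))
    rwa [hs0] at h
  refine ⟨⟨U, U.isOpen_of_mem_nhds hUn, ?_, φ, φ.continuousOn.mono hUsub, φ.injOn.mono hUsub, hφ₀,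
    N, ?_, ?_, ?_, ?_⟩⟩
  · refine (isCompact_closedBall (0 : F) (r ^ N)).image_of_continuousOn
      (φ.continuousOn_symm.mono fun x hx => htgt x (hNN₀ x (mem_closedBall_zero_iff.1 hx)))
  · exact fun x hx => ⟨φ.symm x, ⟨x, mem_closedBall_zero_iff.2 hx, rfl⟩, hφs x hx⟩
  · intro W hW
    obtain ⟨n, hn⟩ := hball (φ.symm ⁻¹' W) (hsc (by rwa [hs0]))
    refine ⟨n, fun g hg hgn => ?_⟩
    have := hn _ hgn
    rwa [mem_preimage, φ.left_inv (hUsub hg)] at this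
  · rintro _ ⟨x, hx, rfl⟩ _ ⟨y, hy, rfl⟩ _ ⟨y', hy', rfl⟩
    rw [mem_closedBall_zero_iff] at hx hy hy'
    rw [hφs y hy, hφs y' hy']
    exact hL x y y' (hNN₀ x hx) (hNN₀ y hy) (hNN₀ y' hy')
  · rintro _ ⟨x, hx, rfl⟩ _ ⟨y, hy, rfl⟩ _ ⟨y', hy', rfl⟩
    rw [mem_closedBall_zero_iff] at hx hy hy'
    rw [hφs y hy, hφs y' hy']
    exact hR x y y' (hNN₀ x hx) (hNN₀ y hy) (hNN₀ y' hy')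

/-- A strictly differentiable local law with unit `0` on both sides has derivative
`(x, y) ↦ x + y` at the origin. -/
theorem HasStrictFDerivAt.eq_fst_add_snd {𝕜 F : Type*} [NontriviallyNormedField 𝕜]
    [NormedAddCommGroup F] [NormedSpace 𝕜 F] {μ : F × F → F} {D : F × F →L[𝕜] F}
    (h : HasStrictFDerivAt μ D 0) (hl : ∀ᶠ x in 𝓝 (0 : F), μ (x, 0) = x)
    (hr : ∀ᶠ x in 𝓝 (0 : F), μ (0, x) = x) :
    D = ContinuousLinearMap.fst 𝕜 F F + ContinuousLinearMap.snd 𝕜 F F := by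
  have h₁ : D.comp (ContinuousLinearMap.inl 𝕜 F F) = ContinuousLinearMap.id 𝕜 F := by
    have h' : HasFDerivAt μ D (ContinuousLinearMap.inl 𝕜 F F 0) := by
      rw [map_zero]; exact h.hasFDerivAt
    have := h'.comp (0 : F) (ContinuousLinearMap.inl 𝕜 F F).hasFDerivAt
    exact this.unique ((hasFDerivAt_id _).congr_of_eventuallyEq hl)
  have h₂ : D.comp (ContinuousLinearMap.inr 𝕜 F F) = ContinuousLinearMap.id 𝕜 F := by
    have h' : HasFDerivAt μ D (ContinuousLinearMap.inr 𝕜 F F 0) := by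
      rw [map_zero]; exact h.hasFDerivAt
    have := h'.comp (0 : F) (ContinuousLinearMap.inr 𝕜 F F).hasFDerivAt
    exact this.unique ((hasFDerivAt_id _).congr_of_eventuallyEq hr)
  ext x
  · simpa using congr($h₁ x)
  · simpa using congr($h₂ x)

/-- A chart at 1, recentred and composed with a linear isomorphism to `Fin d → ℚ_[p]`, makes
multiplication analytic, hence strictly differentiable, at the origin; the unit laws determine the
derivative. -/
theorem LieGroup.exists_standardCoordinates {p q : ℕ} [Fact p.Prime] (hq : q ≠ 0)
    (hq₁ : ‖(q : ℚ_[p])‖ < 1) (E : Type*) [NormedAddCommGroup E] [NormedSpace ℚ_[p] E]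
    [FiniteDimensional ℚ_[p] E] (G : Type*) [Group G] [TopologicalSpace G] [ChartedSpace E G]
    [LieGroup 𝓘(ℚ_[p], E) ω G] : ∃ d, Nonempty (StandardCoordinates p q d G) := by
  have : IsTopologicalGroup G := topologicalGroup_of_lieGroup 𝓘(ℚ_[p], E) ω
  have : CompleteSpace E := FiniteDimensional.complete ℚ_[p] E
  set d := Module.finrank ℚ_[p] E
  let L : E ≃L[ℚ_[p]] (Fin d → ℚ_[p]) := ContinuousLinearEquiv.ofFinrankEq (by simp [d])
  set ψ := chartAt E (1 : G)
  set c : E := ψ 1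
  let φ : OpenPartialHomeomorph G (Fin d → ℚ_[p]) :=
    ψ.transHomeomorph (L.toHomeomorph.trans (Homeomorph.addRight (-(L c))))
  have hφ : ∀ g, φ g = L (ψ g) - L c := fun g => (sub_eq_add_neg _ _).symm
  have hφs : ∀ x, φ.symm x = ψ.symm (L.symm x + c) := fun x => by
    change ψ.symm (L.symm (x + - -(L c))) = _
    simp
  have hφ1 : (1 : G) ∈ φ.source := mem_chart_source E (1 : G)
  have hφ0 : φ 1 = 0 := by rw [hφ]; exact sub_self _
  have h0 : (0 : Fin d → ℚ_[p]) ∈ φ.target := hφ0 ▸ φ.map_source hφ1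
  have hs0 : φ.symm 0 = 1 := by rw [← hφ0, φ.left_inv hφ1]
  have hμ : AnalyticAt ℚ_[p] (fun z : (Fin d → ℚ_[p]) × (Fin d → ℚ_[p]) =>
      φ (φ.symm z.1 * φ.symm z.2)) 0 := by
    have h := (contMDiffAt_iff.1 ((contMDiff_mul 𝓘(ℚ_[p], E) ω (G := G)).contMDiffAt
      (x := ((1 : G), (1 : G))))).2
    have h : ContDiffAt ℚ_[p] ω (fun z : E × E => ψ (ψ.symm z.1 * ψ.symm z.2)) (c, c) := by
      simpa [ψ, c, Function.comp_def, contDiffWithinAt_univ] using! h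
    have hA : AnalyticAt ℚ_[p] (fun z : (Fin d → ℚ_[p]) × (Fin d → ℚ_[p]) =>
        (L.symm z.1 + c, L.symm z.2 + c)) 0 := by
      apply ContDiffAt.analyticAt
      fun_prop
    have hB : AnalyticAt ℚ_[p] (fun z => L z - L c) (ψ (ψ.symm c * ψ.symm c)) := by
      apply ContDiffAt.analyticAt
      fun_prop
    have h' : AnalyticAt ℚ_[p] (fun z : E × E => L (ψ (ψ.symm z.1 * ψ.symm z.2)) - L c) (c, c) :=
      AnalyticAt.comp (g := fun z => L z - L c)
        (f := fun z : E × E => ψ (ψ.symm z.1 * ψ.symm z.2)) hB h.analyticAt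
    have := AnalyticAt.comp_of_eq h' hA (by simp)
    refine this.congr (Filter.Eventually.of_forall fun z => ?_)
    simp [hφ, hφs]
  have hd := hμ.hasStrictFDerivAt
  have hnhd : ∀ᶠ x in 𝓝 (0 : Fin d → ℚ_[p]), φ (φ.symm x) = x := by
    filter_upwards [φ.open_target.mem_nhds h0] with x hx using φ.right_inv hx
  rw [hd.eq_fst_add_snd (by simpa [hs0] using hnhd) (by simpa [hs0] using hnhd)] at hd
  exact ⟨d, StandardCoordinates.nonempty_of_hasStrictFDerivAt hq hq₁ φ hφ1 hφ0 hd⟩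

/-! ### Vector stabilizers and procyclic subgroups. -/

namespace Representation

variable {k G V : Type*} [CommSemiring k] [Group G]

theorem IsSmooth.setOf_apply_eq_mem_nhds [TopologicalSpace G] [AddCommMonoid V] [Module k V]
    {ρ : Representation k G V} (h : ρ.IsSmooth) (v : V) : {g | ρ g v = v} ∈ 𝓝 (1 : G) := by
  let _ : TopologicalSpace V := ⊥
  have : DiscreteTopology V := ⟨rfl⟩
  have hc : Continuous fun g : G => ρ g v := Continuous.comp (g := fun x : G × V => ρ x.1 x.2) h
    (Continuous.prodMk_left v)
  exact ((isOpen_discrete {v}).preimage hc).mem_nhds (by simp)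

/-- The stabilizer of a vector, as a subgroup. -/
def vectorStabilizer [AddCommMonoid V] [Module k V] (ρ : Representation k G V) (v : V) :
    Subgroup G where
  carrier := {g | ρ g v = v}
  one_mem' := by simp
  mul_mem' {a b} ha hb := by
    simp only [mem_ofPred_eq] at ha hb ⊢
    rw [map_mul, Module.End.mul_apply, hb, ha]
  inv_mem' {a} ha := by
    simp only [mem_ofPred_eq] at ha ⊢
    conv_lhs => rw [← ha]
    rw [← Module.End.mul_apply, ← map_mul, inv_mul_cancel, map_one, Module.End.one_apply]

theorem mem_vectorStabilizer [AddCommMonoid V] [Module k V] {ρ : Representation k G V} {v : V}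
    {g : G} : g ∈ ρ.vectorStabilizer v ↔ ρ g v = v := Iff.rfl

theorem isSmooth_of_vectorStabilizer_mem_nhds [TopologicalSpace G] [IsTopologicalGroup G]
    [AddCommMonoid V] [Module k V] {ρ : Representation k G V}
    (h : ∀ v, (ρ.vectorStabilizer v : Set G) ∈ 𝓝 1) : ρ.IsSmooth := by
  let _ : TopologicalSpace V := ⊥
  have : DiscreteTopology V := ⟨rfl⟩
  change Continuous fun x : G × V => ρ x.1 x.2
  rw [continuous_prod_of_discrete_right]
  intro v
  rw [continuous_discrete_rng]
  intro w
  rw [isOpen_iff_mem_nhds]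
  rintro g rfl
  have hg : Filter.Tendsto (fun x => g⁻¹ * x) (𝓝 g) (𝓝 1) := by
    have := (continuous_const_mul g⁻¹).tendsto g
    rwa [inv_mul_cancel] at this
  filter_upwards [hg (h v)] with x hx
  rw [mem_preimage, SetLike.mem_coe, mem_vectorStabilizer] at hx
  have : ρ x v = ρ g (ρ (g⁻¹ * x) v) := by
    rw [← Module.End.mul_apply, ← map_mul, mul_inv_cancel_left]
  exact this.trans (by rw [hx])

/-- Let `h` act on `v` by a translation by `ρ h v - v`, invariant under the compact group `B`
topologically generated by `h`, and let `ρ y v - v` be a smooth vector killed by `q` for `y ∈ B`.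
Then the closed subgroup generated by `h ^ q` fixes `v`. -/
theorem topologicalClosure_zpowers_pow_le_vectorStabilizer [TopologicalSpace G]
    [IsTopologicalGroup G] [T2Space G] [AddCommGroup V] [Module k V]
    {ρ : Representation k G V} {h : G} {v : V} {q : ℕ}
    (hcomp : IsCompact ((Subgroup.zpowers h).topologicalClosure : Set G))
    (hfix : (Subgroup.zpowers h).topologicalClosure ≤ ρ.vectorStabilizer (ρ h v - v))
    (hsmooth : ∀ y ∈ (Subgroup.zpowers h).topologicalClosure,
      (ρ.vectorStabilizer (ρ y v - v) : Set G) ∈ 𝓝 1)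
    (hq : ∀ y ∈ (Subgroup.zpowers h).topologicalClosure, q • (ρ y v - v) = 0) :
    (Subgroup.zpowers (h ^ q)).topologicalClosure ≤ ρ.vectorStabilizer v := by
  set B := (Subgroup.zpowers h).topologicalClosure
  have hB : ∀ y ∈ B, y * h = h * y := by
    intro y hy
    have hcl : IsClosed {y : G | y * h = h * y} := isClosed_eq (by fun_prop) (by fun_prop)
    refine closure_minimal ?_ hcl hy
    rintro _ ⟨m, rfl⟩
    exact (Commute.zpow_self h m).eq
  -- As `y` commutes with `h`, `y` fixing `ρ h v - v` amounts to `h` fixing `ρ y v - v`; the latter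
  -- has an open, hence closed, stabilizer, which thus contains `B`.
  have hinv : ∀ y ∈ B, B ≤ ρ.vectorStabilizer (ρ y v - v) := by
    intro y hy
    refine Subgroup.topologicalClosure_minimal _ ?_
      (Subgroup.isClosed_of_isOpen _ (Subgroup.isOpen_of_mem_nhds _ (hsmooth y hy)))
    rw [Subgroup.zpowers_le, mem_vectorStabilizer, map_sub, ← Module.End.mul_apply, ← map_mul,
      ← hB y hy, map_mul, Module.End.mul_apply]
    have := mem_vectorStabilizer.1 (hfix hy)
    rw [map_sub] at this
    have e : ρ y (ρ h v) = ρ h v - v + ρ y v := by rw [← this]; abel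
    rw [e]
    abel
  have hpow : ∀ y ∈ B, ∀ m : ℕ, ρ (y ^ m) v = v + m • (ρ y v - v) := by
    intro y hy m
    induction m with
    | zero => simp
    | succ m ih =>
      have h₁ : ρ y (ρ y v - v) = ρ y v - v := hinv y hy hy
      rw [pow_succ', map_mul, Module.End.mul_apply, ih, map_add, map_nsmul, h₁, succ_nsmul]
      abel
  have himage : IsClosed ((· ^ q) '' (B : Set G)) :=
    (hcomp.image (continuous_pow q)).isClosed
  intro x hx
  -- The stabilizer of `v` is not known to be closed, so every limit point must itself be exhibited
  -- as a q-th power from `B`.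
  have hx' : x ∈ (· ^ q) '' (B : Set G) := by
    refine closure_minimal ?_ himage hx
    rintro _ ⟨m, rfl⟩
    refine ⟨h ^ m, Subgroup.le_topologicalClosure _ ⟨m, rfl⟩, ?_⟩
    change (h ^ m) ^ q = (h ^ q) ^ m
    rw [← zpow_natCast, ← zpow_natCast, ← zpow_mul, ← zpow_mul, mul_comm]
  obtain ⟨y, hy, rfl⟩ := hx'
  change ρ (y ^ q) v = v
  rw [hpow y hy, hq y hy, add_zero]

end Representation

/-! ### Smoothness of extensions. -/

/-- An extension of smooth representations of a group with standard coordinates is smooth, over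
coefficients killed by `q`. -/
theorem StandardCoordinates.isSmooth_of_exact {p q d : ℕ} [Fact p.Prime] {G : Type*} [Group G]
    [TopologicalSpace G] [IsTopologicalGroup G] [T2Space G] (κ : StandardCoordinates p q d G)
    (hq : q ≠ 0) (hq₁ : ‖(q : ℚ_[p])‖ < 1) {k V₁ V₂ V₃ : Type*} [CommRing k] (hqk : (q : k) = 0)
    [AddCommGroup V₁] [Module k V₁] [AddCommGroup V₂] [Module k V₂] [AddCommGroup V₃] [Module k V₃]
    {ρ₁ : Representation k G V₁} {ρ₂ : Representation k G V₂} {ρ₃ : Representation k G V₃}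
    (f : ρ₁.IntertwiningMap ρ₂) (g : ρ₂.IntertwiningMap ρ₃)
    (hfg : Function.Exact f g) (h₁ : ρ₁.IsSmooth) (h₃ : ρ₃.IsSmooth) : ρ₂.IsSmooth := by
  refine Representation.isSmooth_of_vectorStabilizer_mem_nhds fun v => ?_
  set S := ρ₂.vectorStabilizer v
  set K := ρ₃.vectorStabilizer (g v)
  have hKnhds : (K : Set G) ∈ 𝓝 1 := h₃.setOf_apply_eq_mem_nhds _
  have hr : ‖(q : ℚ_[p])‖ ≤ 1 := hq₁.le
  have hK : IsClosed (K : Set G) := K.isClosed_of_isOpen (K.isOpen_of_mem_nhds hKnhds)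
  have hrange : ∀ y ∈ K, ∃ w, f w = ρ₂ y v - v := fun y hy =>
    (hfg _).1 (by rw [map_sub, g.isIntertwining, sub_eq_zero]; exact hy)
  have hsmooth : ∀ y ∈ K, (ρ₂.vectorStabilizer (ρ₂ y v - v) : Set G) ∈ 𝓝 1 := fun y hy => by
    obtain ⟨w, hw⟩ := hrange y hy
    filter_upwards [h₁.setOf_apply_eq_mem_nhds w] with x hx
    rw [SetLike.mem_coe, Representation.mem_vectorStabilizer, ← hw, ← f.isIntertwining, hx]
  obtain ⟨n₀, hn₀⟩ := κ.mem_of_small _ hKnhds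
  -- Small enough to lie in `K`, and small enough for the coordinates to be attained.
  set M₀ := max n₀ κ.radius
  have hx : ∀ i : Fin d, ‖(q : ℚ_[p]) ^ M₀ • (Pi.single i 1 : Fin d → ℚ_[p])‖ ≤
      ‖(q : ℚ_[p])‖ ^ M₀ := fun i => by
    rw [norm_smul, norm_pow, Pi.norm_single, norm_one, mul_one]
  choose a haU ha using fun i => κ.exists_coord_eq _
    ((hx i).trans (pow_le_pow_of_le_one (norm_nonneg _) hr (le_max_right _ _)))
  have haK : ∀ i, a i ∈ K := fun i => hn₀ _ (haU i) (by
    rw [ha]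
    exact (hx i).trans (pow_le_pow_of_le_one (norm_nonneg _) hr (le_max_left _ _)))
  have hapow : ∀ i m, ‖κ.coord (a i ^ q ^ m) - (q : ℚ_[p]) ^ (M₀ + m) • Pi.single i 1‖ ≤
      ‖(q : ℚ_[p])‖ ^ (M₀ + m + 1) := fun i m => by
    have := κ.norm_coord_pow_pow_sub (haU i) (hx i) (by rw [ha, sub_self, norm_zero]; positivity) m
    rwa [smul_smul, ← pow_add, add_comm m] at this
  have hfixed : ∀ i, ∃ n, ∀ m, n ≤ m →
      a i ^ q ^ m ∈ ρ₂.vectorStabilizer (ρ₂ (a i) v - v) := fun i => by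
    obtain ⟨n, hn⟩ := κ.mem_of_small _ (hsmooth _ (haK i))
    refine ⟨n, fun m hm => hn _ (κ.carrier.pow_mem (haU i) _) ?_⟩
    have hs : ‖(q : ℚ_[p]) ^ (M₀ + m) • (Pi.single i 1 : Fin d → ℚ_[p])‖ ≤
        ‖(q : ℚ_[p])‖ ^ (M₀ + m) := by
      rw [norm_smul, norm_pow, Pi.norm_single, norm_one, mul_one]
    have := IsUltrametricDist.norm_add_le_of_norm_le
      ((hapow i m).trans (pow_le_pow_of_le_one (norm_nonneg _) hr (by lia))) hs
    rw [sub_add_cancel] at this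
    exact this.trans (pow_le_pow_of_le_one (norm_nonneg _) hr (by lia))
  choose n hn using hfixed
  set m := Finset.univ.sup n
  have hS : ∀ i, (Subgroup.zpowers (a i ^ q ^ (m + 1))).topologicalClosure ≤ S := fun i => by
    set h := a i ^ q ^ m
    have hhK : (Subgroup.zpowers h).topologicalClosure ≤ K :=
      Subgroup.topologicalClosure_minimal _ (by simpa using K.pow_mem (haK i) _) hK
    have hhU : (Subgroup.zpowers h).topologicalClosure ≤ κ.carrier :=
      Subgroup.topologicalClosure_minimal _ (by simpa using κ.carrier.pow_mem (haU i) _)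
        κ.isCompact.isClosed
    have hh : h ∈ ρ₂.vectorStabilizer (ρ₂ (a i) v - v) :=
      hn i m (Finset.le_sup (Finset.mem_univ i))
    -- Cocycle relation c(a^(j+1)) = a^j c(a) + c(a^j), where `h` commutes with a; the case `j = q ^
    -- m` says that `h` fixes c(h).
    have hh' : ∀ j : ℕ, h ∈ ρ₂.vectorStabilizer (ρ₂ (a i ^ j) v - v) := fun j => by
      induction j with
      | zero => simp [Representation.mem_vectorStabilizer]
      | succ j ih =>
        have e : ρ₂ (a i ^ (j + 1)) v - v =
            ρ₂ (a i ^ j) (ρ₂ (a i) v - v) + (ρ₂ (a i ^ j) v - v) := by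
          rw [pow_succ, map_mul, Module.End.mul_apply, map_sub]
          abel
        have hc : h * a i ^ j = a i ^ j * h := ((Commute.refl (a i)).pow_pow _ _).eq
        rw [Representation.mem_vectorStabilizer] at hh ih ⊢
        rw [e, map_add, ih, ← Module.End.mul_apply, ← map_mul, hc, map_mul,
          Module.End.mul_apply, hh]
    rw [pow_succ, pow_mul]
    refine Representation.topologicalClosure_zpowers_pow_le_vectorStabilizer
      (κ.isCompact.of_isClosed_subset (Subgroup.isClosed_topologicalClosure _) hhU) ?_
      (fun y hy => hsmooth y (hhK hy)) fun y _ => ?_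
    · exact Subgroup.topologicalClosure_minimal _ (by simpa using hh' (q ^ m))
        (Subgroup.isClosed_of_isOpen _ (Subgroup.isOpen_of_mem_nhds _
          (hsmooth _ (K.pow_mem (haK i) _))))
    · rw [← Nat.cast_smul_eq_nsmul k, hqk, zero_smul]
  filter_upwards [κ.setOf_norm_coord_le_mem_nhds hq (M₀ + (m + 1))] with x hx
  exact κ.mem_of_topologicalClosure_zpowers_le hq hq₁
    (fun i => κ.carrier.pow_mem (haU i) _) (fun i => hapow i (m + 1)) hS hx.1 hx.2

/-- `G` is a `p`-adic analytic group: a group object in finite-dimensional analytic manifolds over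
`ℚ_[p]`, modelled on some finite-dimensional `ℚ_[p]`-vector space `E`. The prime `p` is unrelated
to the characteristic of `k`. -/
theorem corollary4p4 (p : ℕ) [Fact p.Prime]
    {E : Type*} [NormedAddCommGroup E] [NormedSpace ℚ_[p] E] [FiniteDimensional ℚ_[p] E]
    {G : Type v} [Group G] [TopologicalSpace G] [ChartedSpace E G] [LieGroup 𝓘(ℚ_[p], E) ω G]
    {k : Type u} [Field k] (hk : 0 < ringChar k)
    (S : CategoryTheory.ShortComplex (Rep.{w} k G)) (hS : S.ShortExact)
    (h₁ : S.X₁.ρ.IsSmooth) (h₃ : S.X₃.ρ.IsSmooth) :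
    S.X₂.ρ.IsSmooth := by
  have hp : p.Prime := Fact.out
  have : IsTopologicalGroup G := topologicalGroup_of_lieGroup 𝓘(ℚ_[p], E) ω
  -- Charts give T1, which for a topological group already implies Hausdorff.
  have : T1Space G := ChartedSpace.t1Space E G
  have hq : p * ringChar k ≠ 0 := mul_ne_zero hp.ne_zero hk.ne'
  have hq₁ : ‖((p * ringChar k : ℕ) : ℚ_[p])‖ < 1 := by
    rw [Nat.cast_mul, norm_mul]
    exact mul_lt_one_of_nonneg_of_lt_one_left (norm_nonneg _) Padic.norm_p_lt_one
      (Padic.norm_natCast_le_one _)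
  obtain ⟨d, ⟨κ⟩⟩ := LieGroup.exists_standardCoordinates hq hq₁ E G
  refine κ.isSmooth_of_exact hq hq₁ (by simp) S.f.hom S.g.hom ?_ h₁ h₃
  have hrange : LinearMap.range S.f.hom.toLinearMap = LinearMap.ker S.g.hom.toLinearMap :=
    (hS.exact.map (CategoryTheory.forget₂ (Rep k G) (ModuleCat k))).moduleCat_range_eq_ker
  intro x
  exact (SetLike.ext_iff.1 hrange x).symm
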